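/- Let $V$ be a finite-dimensional real vector space, let $\mathcal{K}(V)$ be the set of nonempty compact convex subsets of $V$ with the topology of the Hausdorff metric (of any norm on $V$), and let $A$ be a Hausdorff topological abelian group. Let $\varphi\colon\mathcal{K}(V)\to A$ be continuous, translation-invariant (that is, $\varphi(v+X)=\varphi(X)$ for all $v\in V$ and $X\in\mathcal{K}(V)$) and a valuation (that is, $\varphi(B\cup C)=\varphi(B)+\varphi(C)-\varphi(B\cap C)$ whenever $B,C,B\cup C\in\mathcal{K}(V)$). Let $X\in\mathcal{K}(V)$ and let $d$ be an integer with $d\geqslant\dim X$, where $\dim X$ is the dimension of the affine span of $X$; for example $d=\dim V$ or $d=\dim X$. Then there are a constant $f_0\in A$ and continuous semigroup homomorphisms $f_1,\dots,f_d\colon[0,\infty)\to A$, where $[0,\infty)$ is a semigroup under addition, such that $$\varphi(\lambda X)=f_0+f_1(\lambda^1)+\cdots+f_d(\lambda^d)\qquad\text{for all }\lambda\in[0,\infty),$$ and $f_0,f_1,\dots,f_d$ are uniquely determined by this. -/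

import Mathlib

open scoped NNReal Pointwise

/-- `φ` is a valuation on convex bodies: `φ (B ∪ C) = φ B + φ C - φ (B ∩ C)` whenever
`B`, `C` and `B ∪ C` are convex bodies. (If `B ∪ C` is convex then it is connected, so the closed
sets `B` and `C` meet, and `B ∩ C` is automatically a convex body as well.) -/
def IsConvexBodyValuation {V A : Type*} [NormedAddCommGroup V] [NormedSpace ℝ V]
    [AddCommGroup A] (φ : ConvexBody V → A) : Prop :=
  ∀ B C U I : ConvexBody V, (U : Set V) = (B : Set V) ∪ C → (I : Set V) = (B : Set V) ∩ C →
    φ U = φ B + φ C - φ I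

/-- `φ` takes equal values on a convex body `X` and on each translate `v + X`. -/
def IsTranslationInvariantOnBodies {V A : Type*} [NormedAddCommGroup V] [NormedSpace ℝ V]
    (φ : ConvexBody V → A) : Prop :=
  ∀ (v : V) (X Y : ConvexBody V), (Y : Set V) = v +ᵥ (X : Set V) → φ Y = φ X

/-- The dimension of a convex body: the dimension of its affine span. -/
noncomputable def convexBodyDim {V : Type*} [NormedAddCommGroup V] [NormedSpace ℝ V]
    (X : ConvexBody V) : ℕ :=
  Module.finrank ℝ (affineSpan ℝ (X : Set V)).direction

/-! The theorem splits into two facts about $g(t)=\varphi(tX)$: it is a Fréchet polynomial of degree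
at most $\dim X$, and a continuous Fréchet polynomial on $[0,\infty)$ is uniquely a sum of terms
$f_i(t^i)$ and a constant.

For the second fact, the top-order difference of $g$ is symmetric, additive and continuous in each
step. A symmetric biadditive map on $[0,\infty)$, continuous in each variable, depends only on the
product of its arguments (`biadditive_eq_mul`), so the top difference depends only on the product of
the steps. This gives a leading term to subtract (`exists_leading_hom`). All divisions take place in
$[0,\infty)$, never in $A$. Uniqueness holds because the same differences recover the top component.

For the first fact, let $C$ be a cone with apex $0$ over $K$. Then $(a+b)C$ is the union of $aC$ and
$aK+bC$, which meet in $aK$. A difference of $t\mapsto\varphi(tC)$ thus involves only $K$ and the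
valuations $\varphi$ and $\varphi(\cdot+bC)$, so induction on the number $n$ of points gives degree
below $n$ (`polyDegLT_polytope_card`). If there are more points than the dimension requires, a Radon
partition gives an alternating relation expressing the polytope by polytopes on fewer of the points
(`altSum_eq_zero`). Approximation by polytopes inside $X$ finishes the argument. -/

/-! ### Fréchet polynomials and iterated differences. -/

section IteratedDifferences

variable {A : Type*} [AddCommGroup A]

/-- The iterated forward difference of `g` along a list of steps. -/
def iterDiff : List ℝ≥0 → (ℝ≥0 → A) → ℝ≥0 → A
  | [], g => g
  | h :: l, g => fwdDiff h (iterDiff l g)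

/-- `g` is a polynomial map of degree less than `n` in the sense of Fréchet: all its `n`-fold
forward differences vanish. -/
def PolyDegLT (n : ℕ) (g : ℝ≥0 → A) : Prop :=
  ∀ l : List ℝ≥0, l.length = n → ∀ t, iterDiff l g t = 0

theorem iterDiff_cons (h : ℝ≥0) (l : List ℝ≥0) (g : ℝ≥0 → A) (t : ℝ≥0) :
    iterDiff (h :: l) g t = iterDiff l g (t + h) - iterDiff l g t := rfl

theorem iterDiff_append (l m : List ℝ≥0) (g : ℝ≥0 → A) :
    iterDiff (l ++ m) g = iterDiff l (iterDiff m g) := by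
  induction l with
  | nil => rfl
  | cons h l ih => simp only [List.cons_append, iterDiff, ih]

theorem iterDiff_perm {l m : List ℝ≥0} (h : l.Perm m) (g : ℝ≥0 → A) :
    iterDiff l g = iterDiff m g := by
  induction h with
  | nil => rfl
  | cons x _ ih => simp only [iterDiff, ih]
  | swap x y l =>
    funext t
    simp only [iterDiff_cons, add_right_comm t x y]
    abel
  | trans _ _ ih₁ ih₂ => exact ih₁.trans ih₂

theorem iterDiff_sub (l : List ℝ≥0) (f g : ℝ≥0 → A) (t : ℝ≥0) :
    iterDiff l (fun s => f s - g s) t = iterDiff l f t - iterDiff l g t := by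
  induction l generalizing t with
  | nil => rfl
  | cons h l ih => simp only [iterDiff_cons, ih]; abel

theorem iterDiff_zero (l : List ℝ≥0) (t : ℝ≥0) : iterDiff l (fun _ => (0 : A)) t = 0 := by
  induction l generalizing t with
  | nil => rfl
  | cons h l ih => simp only [iterDiff_cons, ih, sub_self]

theorem iterDiff_add (l : List ℝ≥0) (f g : ℝ≥0 → A) (t : ℝ≥0) :
    iterDiff l (fun s => f s + g s) t = iterDiff l f t + iterDiff l g t := by
  induction l generalizing t with
  | nil => rfl
  | cons h l ih => simp only [iterDiff_cons, ih]; abel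

theorem iterDiff_sum {ι : Type*} (I : Finset ι) (l : List ℝ≥0) (f : ι → ℝ≥0 → A) (t : ℝ≥0) :
    iterDiff l (fun s => ∑ i ∈ I, f i s) t = ∑ i ∈ I, iterDiff l (f i) t := by
  induction l generalizing t with
  | nil => rfl
  | cons h l ih => simp only [iterDiff_cons, ih, Finset.sum_sub_distrib]

theorem iterDiff_map {B : Type*} [AddCommGroup B] (F : B →+ A) (l : List ℝ≥0) (g : ℝ≥0 → B)
    (t : ℝ≥0) : iterDiff l (fun s => F (g s)) t = F (iterDiff l g t) := by
  induction l generalizing t with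
  | nil => rfl
  | cons h l ih => simp only [iterDiff_cons, ih, map_sub]

theorem iterDiff_continuous [TopologicalSpace A] [IsTopologicalAddGroup A] (l : List ℝ≥0)
    {g : ℝ≥0 → A} (hg : Continuous g) : Continuous (iterDiff l g) := by
  induction l with
  | nil => exact hg
  | cons h l ih =>
    exact (ih.comp (continuous_id.add continuous_const)).sub ih

namespace PolyDegLT

variable {n m : ℕ} {f g : ℝ≥0 → A}

theorem succ (h : PolyDegLT n g) : PolyDegLT (n + 1) g := by
  rintro (_ | ⟨x, l⟩) hl t
  · simp at hl
  · have hl' : l.length = n := by simpa using hl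
    rw [iterDiff_cons, h l hl', h l hl', sub_self]

theorem mono (h : PolyDegLT n g) (hnm : n ≤ m) : PolyDegLT m g := by
  induction hnm with
  | refl => exact h
  | step _ ih => exact ih.succ

theorem add (hf : PolyDegLT n f) (hg : PolyDegLT n g) : PolyDegLT n (fun t => f t + g t) :=
  fun l hl t => by rw [iterDiff_add, hf l hl, hg l hl, add_zero]

theorem sub (hf : PolyDegLT n f) (hg : PolyDegLT n g) : PolyDegLT n (fun t => f t - g t) :=
  fun l hl t => by rw [iterDiff_sub, hf l hl, hg l hl, sub_zero]

/-- Difference operators commute, so any chosen step may be taken first. -/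
theorem of_fwdDiff (h : ∀ b, PolyDegLT n (fun t => g (t + b) - g t)) : PolyDegLT (n + 1) g := by
  rintro (_ | ⟨x, l⟩) hl t
  · simp at hl
  · have hp : (x :: l).Perm (l ++ [x]) := (List.perm_append_singleton x l).symm
    rw [iterDiff_perm hp, iterDiff_append]
    exact h x l (by simpa using hl) t

theorem of_const (h : ∀ t, g t = g 0) : PolyDegLT 1 g :=
  of_fwdDiff fun b l _ t => by
    have : (fun t => g (t + b) - g t) = fun _ => (0 : A) := by
      funext s; rw [h, h s, sub_self]
    rw [this, iterDiff_zero]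

theorem eq_const (h : PolyDegLT 1 g) (t : ℝ≥0) : g t = g 0 := by
  have := h [t] rfl 0
  rw [iterDiff_cons, zero_add] at this
  exact sub_eq_zero.1 this

theorem of_tendsto [TopologicalSpace A] [IsTopologicalAddGroup A] [T2Space A]
    {ι : Type*} {F : Filter ι} [F.NeBot] {u : ι → ℝ≥0 → A} (hu : ∀ i, PolyDegLT n (u i))
    (hlim : ∀ t, Filter.Tendsto (fun i => u i t) F (nhds (g t))) : PolyDegLT n g := by
  intro l hl t
  have key : ∀ (l : List ℝ≥0) (t : ℝ≥0),
      Filter.Tendsto (fun i => iterDiff l (u i) t) F (nhds (iterDiff l g t)) := by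
    intro l
    induction l with
    | nil => exact hlim
    | cons h l ih => exact fun t => (ih (t + h)).sub (ih t)
  refine tendsto_nhds_unique (key l t) ?_
  simp only [hu _ l hl t]
  exact tendsto_const_nhds

end PolyDegLT

/-! ### Differences of monomials, and uniqueness of the components. -/

/-- By the binomial theorem one difference with step $h$ turns $s^m$ into lower powers with leading
term $mh\,s^{m-1}$; iterating leaves the factorial times the product of the steps. -/
theorem iterDiff_pow (l : List ℝ≥0) : (∀ m < l.length, ∀ t,
      iterDiff l (fun s : ℝ≥0 => ((s : ℝ)) ^ m) t = 0) ∧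
    ∀ t, iterDiff l (fun s : ℝ≥0 => ((s : ℝ)) ^ l.length) t = l.length.factorial * l.prod := by
  induction l with
  | nil => simp [iterDiff]
  | cons h l ih =>
    have step : ∀ m : ℕ, ∀ t, iterDiff (h :: l) (fun s : ℝ≥0 => ((s : ℝ)) ^ m) t =
        ∑ i ∈ Finset.range m, (h : ℝ) ^ (m - i) * (m.choose i) *
          iterDiff l (fun s : ℝ≥0 => ((s : ℝ)) ^ i) t := by
      intro m t
      have hp : (h :: l).Perm (l ++ [h]) := (List.perm_append_singleton h l).symm
      rw [iterDiff_perm hp, iterDiff_append]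
      have : iterDiff [h] (fun s : ℝ≥0 => ((s : ℝ)) ^ m) = fun s : ℝ≥0 =>
          ∑ i ∈ Finset.range m, (h : ℝ) ^ (m - i) * (m.choose i) * (s : ℝ) ^ i := by
        funext s
        rw [iterDiff_cons]
        simp only [iterDiff, NNReal.coe_add]
        rw [add_pow, Finset.sum_range_succ]
        simp only [tsub_self, pow_zero, mul_one, Nat.choose_self, Nat.cast_one, add_sub_cancel_right]
        exact Finset.sum_congr rfl fun i _ => by ring
      rw [this, iterDiff_sum]
      refine Finset.sum_congr rfl fun i _ => ?_
      exact iterDiff_map (AddMonoidHom.mulLeft ((h : ℝ) ^ (m - i) * (m.choose i))) l _ t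
    constructor
    · intro m hm t
      rw [step]
      refine Finset.sum_eq_zero fun i hi => ?_
      rw [ih.1 i (by simp at hm hi; omega), mul_zero]
    · intro t
      rw [step, List.length_cons, Finset.sum_range_succ, Finset.sum_eq_zero, ih.2]
      · simp [Nat.factorial_succ]
        ring
      · intro i hi
        rw [ih.1 i (by simpa using hi), mul_zero]

/-- An additive map on `[0, ∞)` extended to `ℝ`. -/
noncomputable def AddHom.extendReal (f : ℝ≥0 →ₙ+ A) : ℝ →+ A :=
  AddMonoidHom.mk' (fun x => f x.toNNReal - f (-x).toNNReal) (by
    intro x y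
    -- Additivity of positive minus negative part, with terms moved across so that no subtraction
    -- occurs in $[0,\infty)$.
    have key : (x + y).toNNReal + ((-x).toNNReal + (-y).toNNReal) =
        (-(x + y)).toNNReal + (x.toNNReal + y.toNNReal) := by
      rw [← NNReal.coe_inj]
      have h : ∀ z : ℝ, max z 0 = max (-z) 0 + z := fun z => by
        rcases le_total z 0 with hz | hz
        · rw [max_eq_right hz, max_eq_left (by linarith)]; ring
        · rw [max_eq_left hz, max_eq_right (by linarith)]; ring
      simp only [NNReal.coe_add, Real.coe_toNNReal']
      linarith [h x, h y, h (x + y)]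
    have := congrArg f key
    simp only [map_add] at this
    refine sub_eq_zero.1 ?_
    rw [← sub_eq_zero.2 this]
    abel)

theorem AddHom.extendReal_coe (f : ℝ≥0 →ₙ+ A) (x : ℝ≥0) : f.extendReal x = f x := by
  have h0 : f 0 = 0 := by simpa only [add_zero, left_eq_add] using map_add f 0 0
  simp [AddHom.extendReal, Real.toNNReal_of_nonpos, h0]

/-- Once extended to a group homomorphism on $\mathbb{R}$, $f$ commutes with differences, which
reduces the claim to real monomials. -/
theorem iterDiff_hom_pow_of_lt (f : ℝ≥0 →ₙ+ A) {m : ℕ} (l : List ℝ≥0) (hm : m < l.length)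
    (t : ℝ≥0) : iterDiff l (fun s => f (s ^ m)) t = 0 := by
  simp_rw [← f.extendReal_coe, NNReal.coe_pow]
  rw [iterDiff_map, (iterDiff_pow l).1 m hm, map_zero]

theorem iterDiff_hom_pow (f : ℝ≥0 →ₙ+ A) (l : List ℝ≥0) (t : ℝ≥0) :
    iterDiff l (fun s => f (s ^ l.length)) t = f (l.length.factorial * l.prod) := by
  simp_rw [← f.extendReal_coe, NNReal.coe_pow]
  rw [iterDiff_map, (iterDiff_pow l).2]
  simp

/-- The components of a sum of homogeneous maps are determined by the sum. -/
theorem eq_of_sum_hom_pow_eq (d : ℕ) (c c' : A) (f f' : Fin d → (ℝ≥0 →ₙ+ A))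
    (h : ∀ t : ℝ≥0, c + ∑ i, f i (t ^ ((i : ℕ) + 1)) = c' + ∑ i, f' i (t ^ ((i : ℕ) + 1))) :
    c = c' ∧ f = f' := by
  induction d with
  | zero => exact ⟨by simpa using h 0, Subsingleton.elim _ _⟩
  | succ d ih =>
    have top : ∀ (c : A) (f : Fin (d + 1) → (ℝ≥0 →ₙ+ A)) (l : List ℝ≥0), l.length = d + 1 →
        iterDiff l (fun t => c + ∑ i, f i (t ^ ((i : ℕ) + 1))) 0 =
          f (Fin.last d) ((d + 1).factorial * l.prod) := by
      intro c f l hl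
      rw [iterDiff_add, iterDiff_sum, Fin.sum_univ_castSucc, Finset.sum_eq_zero, zero_add,
        Fin.val_last, ← hl, iterDiff_hom_pow]
      · have hc : PolyDegLT 1 (fun _ : ℝ≥0 => c) := .of_const fun _ => rfl
        rw [(hc.mono (by omega : 1 ≤ l.length)) l rfl, zero_add]
      · intro i _
        exact iterDiff_hom_pow_of_lt _ _ (by simp [hl]) _
    have hlast : f (Fin.last d) = f' (Fin.last d) := by
      ext x
      -- The steps $x/(d+1)!,1,\dots,1$ make the top difference equal to the top component at $x$.
      have hx : (x : ℝ≥0) = (d + 1).factorial *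
          ((x / (d + 1).factorial) :: List.replicate d 1).prod := by
        simp only [List.prod_cons, List.prod_replicate, one_pow, mul_one]
        rw [mul_div_cancel₀]
        exact_mod_cast (Nat.factorial_pos _).ne'
      rw [hx, ← top c f _ (by simp), ← top c' f' _ (by simp)]
      congr 1
      funext t
      exact h t
    have h' := ih (fun i => f i.castSucc) (fun i => f' i.castSucc) fun t => by
      have := h t
      rw [Fin.sum_univ_castSucc, Fin.sum_univ_castSucc, hlast, ← add_assoc, ← add_assoc] at this
      exact add_right_cancel this
    refine ⟨h'.1, funext fun i => ?_⟩
    refine Fin.lastCases hlast (fun j => congrFun h'.2 j) i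

/-- Rational factors move from one argument to the other by additivity, and real factors by
continuity and density. -/
theorem biadditive_eq_mul [TopologicalSpace A] [T2Space A]
    (B : ℝ≥0 → ℝ≥0 → A) (hadd : ∀ x y z, B (x + y) z = B x z + B y z)
    (hsymm : ∀ x y, B x y = B y x) (hcont : ∀ y, Continuous fun x => B x y) (x y : ℝ≥0) :
    B x y = B (x * y) 1 := by
  have h0 : ∀ z, B 0 z = 0 := fun z => by simpa using hadd 0 0 z
  have hnat : ∀ (n : ℕ) x z, B (n * x) z = n • B x z := by
    intro n x z
    induction n with
    | zero => simp [h0]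
    | succ n ih => rw [Nat.cast_succ, add_mul, one_mul, hadd, ih, succ_nsmul]
  have hrat : ∀ (m n : ℕ) x z, B ((m : ℝ≥0) / (n + 1 : ℕ) * x) z = B ((m : ℝ≥0) / (n + 1 : ℕ) * z) x := by
    intro m n x z
    have hn : ((n + 1 : ℕ) : ℝ≥0) ≠ 0 := by positivity
    -- Cutting both arguments into $n+1$ equal parts gives an expression whose symmetry is visible
    -- without dividing in $A$.
    have e : ∀ x z, B ((m : ℝ≥0) / (n + 1 : ℕ) * x) z =
        m • ((n + 1) • B (x / (n + 1 : ℕ)) (z / (n + 1 : ℕ))) := by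
      intro x z
      rw [hsymm (x / _), ← hnat, mul_div_cancel₀ _ hn, hsymm z, ← hnat, mul_div_assoc',
        div_mul_eq_mul_div]
    rw [e, e, hsymm (x / _)]
  have hreal : ∀ r x z, B (r * x) z = B (r * z) x := by
    intro r x z
    have hclosed : IsClosed {r : ℝ≥0 | B (r * x) z = B (r * z) x} :=
      isClosed_eq ((hcont z).comp (continuous_id.mul continuous_const))
        ((hcont x).comp (continuous_id.mul continuous_const))
    have hlim : Filter.Tendsto (fun n : ℕ => (⌊r * (n + 1 : ℕ)⌋₊ : ℝ≥0) / (n + 1 : ℕ))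
        Filter.atTop (nhds r) := by
      rw [← NNReal.tendsto_coe]
      have := (tendsto_nat_floor_mul_div_atTop (R := ℝ) r.coe_nonneg).comp
        (tendsto_natCast_atTop_atTop.comp (Filter.tendsto_add_atTop_nat 1))
      refine this.congr fun n => ?_
      simp only [Function.comp_apply, NNReal.coe_div, NNReal.coe_natCast]
      congr 2
    exact hclosed.mem_of_tendsto hlim (Filter.Eventually.of_forall fun n => hrat _ _ _ _)
  have := hreal x 1 y
  rwa [mul_one] at this

/-- The defect of additivity in the first step is a difference of one order higher, which vanishes.
-/
theorem iterDiff_cons_add {g : ℝ≥0 → A} {l : List ℝ≥0} (hg : PolyDegLT (l.length + 2) g)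
    (h k : ℝ≥0) : iterDiff ((h + k) :: l) g 0 = iterDiff (h :: l) g 0 + iterDiff (k :: l) g 0 := by
  have := hg (k :: h :: l) rfl 0
  simp only [iterDiff_cons, zero_add] at this ⊢
  rw [← sub_eq_zero, ← this, add_comm k h]
  abel

/-! ### Decomposition of continuous Fréchet polynomials. -/

section Continuous

variable [TopologicalSpace A] [IsTopologicalAddGroup A] [T2Space A]

theorem iterDiff_cons_cons {g : ℝ≥0 → A} (hgc : Continuous g) {l : List ℝ≥0}
    (hg : PolyDegLT (l.length + 3) g) (h k : ℝ≥0) :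
    iterDiff (h :: k :: l) g 0 = iterDiff ((h * k) :: 1 :: l) g 0 := by
  refine biadditive_eq_mul (fun h k => iterDiff (h :: k :: l) g 0) (fun x y z => ?_)
    (fun x y => ?_) (fun y => ?_) h k
  · exact iterDiff_cons_add (l := z :: l) hg x y
  · rw [iterDiff_perm (List.Perm.swap y x l)]
  · simp only [iterDiff_cons (l := y :: l), zero_add]
    exact (iterDiff_continuous _ hgc).sub continuous_const

/-- Each step is absorbed into the first one and leaves a $1$ behind; $m$ counts the ones already
collected. -/
theorem iterDiff_eq_prod {g : ℝ≥0 → A} (hgc : Continuous g) (l : List ℝ≥0) (m : ℕ)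
    (hg : PolyDegLT (l.length + m + 2) g) (x : ℝ≥0) :
    iterDiff (x :: (l ++ List.replicate m 1)) g 0 =
      iterDiff ((x * l.prod) :: List.replicate (l.length + m) 1) g 0 := by
  induction l generalizing m x with
  | nil => simp
  | cons k l ih =>
    rw [List.cons_append, iterDiff_cons_cons hgc (hg.mono (by simp; omega)),
      iterDiff_perm (m := (x * k) :: (l ++ List.replicate (m + 1) 1))
        (.cons _ (by rw [List.replicate_succ]; exact List.perm_middle.symm)),
      ih (m + 1) (hg.mono (by simp; omega)), List.prod_cons, mul_assoc, List.length_cons]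
    congr 3
    omega

/-- The leading component of a continuous polynomial map. -/
theorem exists_leading_hom {g : ℝ≥0 → A} (hgc : Continuous g) (n : ℕ) (hg : PolyDegLT (n + 2) g) :
    ∃ f : ℝ≥0 →ₙ+ A, Continuous f ∧ PolyDegLT (n + 1) (fun t => g t - f (t ^ (n + 1))) := by
  -- The division by $(n+1)!$ cancels the factorial in the top difference of $t\mapsto f(t^{n+1})$.
  let f : ℝ≥0 →ₙ+ A :=
    { toFun := fun x => iterDiff ((x / (n + 1).factorial) :: List.replicate n 1) g 0
      map_add' := fun x y => by
        rw [add_div]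
        exact iterDiff_cons_add (hg.mono (by simp)) _ _ }
  have hf : Continuous f := by
    change Continuous fun x : ℝ≥0 =>
      iterDiff ((x / (n + 1).factorial) :: List.replicate n 1) g 0
    simp only [iterDiff_cons, zero_add]
    exact ((iterDiff_continuous _ hgc).comp (continuous_id.div_const _)).sub continuous_const
  have hconst : ∀ {g : ℝ≥0 → A} {l : List ℝ≥0}, PolyDegLT (l.length + 1) g →
      ∀ t, iterDiff l g t = iterDiff l g 0 := by
    intro g l hg t
    have := hg (t :: l) rfl 0
    rwa [iterDiff_cons, zero_add, sub_eq_zero] at this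
  refine ⟨f, hf, fun l hl t => ?_⟩
  rw [iterDiff_sub, ← hl, iterDiff_hom_pow, hconst (hg.mono (by omega))]
  obtain ⟨x, l, rfl⟩ := List.exists_cons_of_length_eq_add_one hl
  have hl' : l.length = n := by simpa using hl
  have := iterDiff_eq_prod hgc l 0 (hg.mono (by omega)) x
  simp only [List.replicate_zero, List.append_nil, add_zero, hl'] at this
  rw [this, sub_eq_zero]
  change _ = iterDiff ((_ / _) :: _) g 0
  rw [hl, mul_div_cancel_left₀ _ (by exact_mod_cast (Nat.factorial_pos _).ne'), List.prod_cons]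

theorem exists_sum_hom_pow {g : ℝ≥0 → A} (hgc : Continuous g) (d : ℕ) (hg : PolyDegLT (d + 1) g) :
    ∃ (c : A) (f : Fin d → (ℝ≥0 →ₙ+ A)), (∀ i, Continuous (f i)) ∧
      ∀ t, g t = c + ∑ i, f i (t ^ ((i : ℕ) + 1)) := by
  induction d generalizing g with
  | zero => exact ⟨g 0, fun i => i.elim0, fun i => i.elim0, fun t => by simpa using hg.eq_const t⟩
  | succ d ih =>
    obtain ⟨f, hf, hfd⟩ := exists_leading_hom hgc d hg
    obtain ⟨c, f', hf', h⟩ := ih (hgc.sub (hf.comp (continuous_pow _))) hfd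
    refine ⟨c, Fin.snoc f' f, fun i => ?_, fun t => ?_⟩
    · refine Fin.lastCases ?_ (fun j => ?_) i
      · simpa using hf
      · simpa using hf' j
    · have : g t - f (t ^ (d + 1)) = _ := h t
      rw [sub_eq_iff_eq_add] at this
      simp [Fin.sum_univ_castSucc, this, add_assoc]

end Continuous

end IteratedDifferences

/-! ### Minkowski sums, cones and simplices. -/

section Valuations

variable {V : Type*} [NormedAddCommGroup V] [NormedSpace ℝ V] {A : Type*} [AddCommGroup A]

/-- Minkowski addition distributes over the intersection of two closed sets with convex union. -/
theorem inter_add_of_convex_union {B C D : Set V} (hB : IsClosed B) (hC : IsClosed C)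
    (hD : Convex ℝ D) (hU : Convex ℝ (B ∪ C)) : B ∩ C + D = (B + D) ∩ (C + D) := by
  refine Set.Subset.antisymm Set.inter_add_subset ?_
  rintro x ⟨⟨b, hb, e, he, rfl⟩, c, hc, e', he', hx⟩
  -- The segment from $b$ to $c$ lies in $B\cup C$, so by connectedness it has a point $pb+qc$ in
  -- $B\cap C$. Since $b+e=c+e'$, adding $pe+qe'$ to it gives back $b+e$.
  have hconn : IsPreconnected (segment ℝ b c) := (convex_segment b c).isPreconnected
  obtain ⟨z, hz, hzB, hzC⟩ := isPreconnected_closed_iff.1 hconn B C hB hC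
    (hU.segment_subset (.inl hb) (.inr hc)) ⟨b, left_mem_segment ℝ b c, hb⟩
    ⟨c, right_mem_segment ℝ b c, hc⟩
  obtain ⟨p, q, hp, hq, hpq, rfl⟩ := hz
  refine ⟨_, ⟨hzB, hzC⟩, p • e + q • e', hD he he' hp hq hpq, ?_⟩
  change c + e' = b + e at hx
  change p • b + q • c + (p • e + q • e') = b + e
  rw [show p • b + q • c + (p • e + q • e') = p • (b + e) + q • (c + e') by module, hx,
    ← add_smul, hpq, one_smul]

/-- This lets the induction for simplices be applied to $Y\mapsto\varphi(Y+bC)$ as well as to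
$\varphi$. -/
theorem IsConvexBodyValuation.comp_add_right {φ : ConvexBody V → A} (h : IsConvexBodyValuation φ)
    (D : ConvexBody V) : IsConvexBodyValuation fun Y => φ (Y + D) := by
  intro B C U I hU hI
  refine h _ _ _ _ ?_ ?_
  · rw [ConvexBody.coe_add, ConvexBody.coe_add, ConvexBody.coe_add, hU, Set.union_add]
  · rw [ConvexBody.coe_add, ConvexBody.coe_add, ConvexBody.coe_add, hI,
      inter_add_of_convex_union B.isClosed C.isClosed D.convex (hU ▸ U.convex)]

theorem IsTranslationInvariantOnBodies.comp_add_right {β : Type*} {φ : ConvexBody V → β}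
    (h : IsTranslationInvariantOnBodies φ) (D : ConvexBody V) :
    IsTranslationInvariantOnBodies fun Y => φ (Y + D) := by
  intro v X Y hY
  refine h v _ _ ?_
  rw [ConvexBody.coe_add, ConvexBody.coe_add, hY, ← Set.singleton_vadd, ← Set.singleton_vadd,
    vadd_eq_add, vadd_eq_add, add_assoc]

/-- The convex body with one point. -/
def ConvexBody.point (v : V) : ConvexBody V :=
  ⟨{v}, convex_singleton v, isCompact_singleton, Set.singleton_nonempty v⟩

theorem IsTranslationInvariantOnBodies.smul_add_point {β : Type*} {φ : ConvexBody V → β}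
    (h : IsTranslationInvariantOnBodies φ) (X : ConvexBody V) (v : V) (t : ℝ≥0) :
    φ (t • (X + ConvexBody.point v)) = φ (t • X) := by
  refine h (t • v) _ _ ?_
  rw [ConvexBody.coe_smul', ConvexBody.coe_add, ConvexBody.coe_smul', smul_add,
    show ((ConvexBody.point v : ConvexBody V) : Set V) = {v} from rfl, Set.smul_set_singleton,
    add_comm, Set.singleton_add]
  rfl

/-- Multiples of a cone with apex `0` over `K`. -/
theorem mem_smul_cone_iff {K C : ConvexBody V}
    (hC : ∀ x, x ∈ C ↔ ∃ s : ℝ, 0 ≤ s ∧ s ≤ 1 ∧ ∃ k ∈ K, x = s • k) (a : ℝ≥0) (x : V) :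
    x ∈ (a • C : ConvexBody V) ↔ ∃ r : ℝ, 0 ≤ r ∧ r ≤ a ∧ ∃ k ∈ K, x = r • k := by
  rw [← SetLike.mem_coe, ConvexBody.coe_smul', Set.mem_smul_set]
  constructor
  · rintro ⟨y, hy, rfl⟩
    obtain ⟨s, hs0, hs1, k, hk, rfl⟩ := (hC y).1 hy
    exact ⟨a * s, by positivity, mul_le_of_le_one_right a.2 hs1, k, hk, smul_smul (a : ℝ) s k⟩
  · rintro ⟨r, hr0, hra, k, hk, rfl⟩
    -- For $a=0$ the quotient is $0$ by convention and $r=0$, so the witness still works.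
    refine ⟨(r / a) • k, (hC _).2 ⟨r / a, by positivity, div_le_one_of_le₀ hra a.2, k, hk, rfl⟩, ?_⟩
    change (a : ℝ) • (r / a) • k = r • k
    rw [smul_smul]
    rcases eq_or_lt_of_le a.2 with ha | ha
    · change 0 = (a : ℝ) at ha
      rw [← ha, zero_mul, le_antisymm (hra.trans ha.ge) hr0]
    · rw [mul_div_cancel₀]
      exact ha.ne'

/-- Convexity gives $aK+rK=(a+r)K$, so adding $bC$ to $aK$ sweeps out the layer of multiples between
$a$ and $a+b$. -/
theorem mem_smul_add_smul_cone_iff {K C : ConvexBody V}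
    (hC : ∀ x, x ∈ C ↔ ∃ s : ℝ, 0 ≤ s ∧ s ≤ 1 ∧ ∃ k ∈ K, x = s • k) (a b : ℝ≥0) (x : V) :
    x ∈ (a • K + b • C : ConvexBody V) ↔
      ∃ r : ℝ, a ≤ r ∧ r ≤ (a + b : ℝ≥0) ∧ ∃ k ∈ K, x = r • k := by
  rw [← SetLike.mem_coe, ConvexBody.coe_add, Set.mem_add]
  constructor
  · rintro ⟨y, hy, z, hz, rfl⟩
    obtain ⟨r, hr0, hrb, k, hk, rfl⟩ := (mem_smul_cone_iff hC b z).1 hz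
    have : y + r • k ∈ ((a : ℝ) + r) • (K : Set V) := by
      rw [K.convex.add_smul a.coe_nonneg hr0]
      exact Set.add_mem_add hy (Set.smul_mem_smul_set hk)
    obtain ⟨k', hk', h⟩ := this
    exact ⟨a + r, by linarith, by push_cast; linarith, k', hk', h.symm⟩
  · rintro ⟨r, har, hr, k, hk, rfl⟩
    push_cast at hr
    refine ⟨(a : ℝ) • k, Set.smul_mem_smul_set (a := a) hk, (r - a) • k,
      (mem_smul_cone_iff hC b _).2 ⟨r - a, by linarith, by linarith, k, hk, rfl⟩, ?_⟩
    rw [← add_smul, add_sub_cancel]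

/-- For $r>0$ the scalars $c$ with $cx\in K$ form an interval containing $s^{-1}$ and $r^{-1}$,
hence $a^{-1}$. For $r=0$ the point is $0$. -/
theorem mem_smul_of_between {K : Set V} (hK : Convex ℝ K) {r a s : ℝ} (hr : 0 ≤ r) (hra : r ≤ a)
    (has : a ≤ s) {x : V} (h₁ : x ∈ r • K) (h₂ : x ∈ s • K) : x ∈ a • K := by
  rcases eq_or_lt_of_le hr with rfl | hr
  · obtain ⟨k, hk, rfl⟩ := h₁
    rcases eq_or_lt_of_le hra with rfl | ha
    · exact ⟨k, hk, rfl⟩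
    · obtain ⟨k', hk', h⟩ := h₂
      have hs : s ≠ 0 := by linarith
      have hk0 : k' = 0 := by
        have : s • k' = (0 : ℝ) • k := h
        rwa [zero_smul, smul_eq_zero, or_iff_right hs] at this
      exact ⟨k', hk', by simp [hk0]⟩
  · have ha : 0 < a := by linarith
    have hs : 0 < s := by linarith
    rw [Set.mem_smul_set_iff_inv_smul_mem₀ (by positivity)] at h₁ h₂ ⊢
    have hconv : Convex ℝ ((fun c : ℝ => c • x) ⁻¹' K) :=
      hK.linear_preimage (LinearMap.toSpanSingleton ℝ V x)
    exact hconv.ordConnected.out h₂ h₁ ⟨by gcongr, by gcongr⟩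

theorem IsConvexBodyValuation.smul_cone {φ : ConvexBody V → A} (h : IsConvexBodyValuation φ)
    {K C : ConvexBody V} (hC : ∀ x, x ∈ C ↔ ∃ s : ℝ, 0 ≤ s ∧ s ≤ 1 ∧ ∃ k ∈ K, x = s • k)
    (a b : ℝ≥0) : φ ((a + b) • C) - φ (a • C) = φ (a • K + b • C) - φ (a • K) := by
  rw [h (a • C) (a • K + b • C) ((a + b) • C) (a • K)]
  · abel
  · ext x
    rw [Set.mem_union, SetLike.mem_coe, SetLike.mem_coe, SetLike.mem_coe, mem_smul_cone_iff hC,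
      mem_smul_cone_iff hC, mem_smul_add_smul_cone_iff hC]
    constructor
    · rintro ⟨r, hr, hr', hk⟩
      rcases le_total r a with hra | hra
      · exact .inl ⟨r, hr, hra, hk⟩
      · exact .inr ⟨r, hra, hr', hk⟩
    · rintro (⟨r, hr, hra, hk⟩ | ⟨r, hra, hr', hk⟩)
      · exact ⟨r, hr, hra.trans (by simp), hk⟩
      · exact ⟨r, a.2.trans hra, hr', hk⟩
  · ext x
    rw [Set.mem_inter_iff, ConvexBody.coe_smul' a K, SetLike.mem_coe, SetLike.mem_coe,
      mem_smul_cone_iff hC, mem_smul_add_smul_cone_iff hC]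
    constructor
    · rintro ⟨k, hk, rfl⟩
      exact ⟨⟨a, a.2, le_rfl, k, hk, rfl⟩, ⟨a, le_rfl, by simp, k, hk, rfl⟩⟩
    · rintro ⟨⟨r, hr, hra, k, hk, rfl⟩, ⟨s, has, -, k', hk', hx⟩⟩
      exact mem_smul_of_between K.convex hr hra has (Set.smul_mem_smul_set hk)
        (hx ▸ Set.smul_mem_smul_set hk')

open Classical in
/-- The convex hull of a finite set of points, as a convex body (`{0}` for the empty set). -/
noncomputable def polytope (S : Finset V) : ConvexBody V :=
  if h : S.Nonempty then
    ⟨convexHull ℝ S, convex_convexHull ℝ _, S.finite_toSet.isCompact_convexHull ℝ,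
      h.to_set.convexHull⟩
  else 0

theorem coe_polytope {S : Finset V} (h : S.Nonempty) :
    (polytope S : Set V) = convexHull ℝ (S : Set V) := by
  rw [polytope, dif_pos h]
  rfl

open Classical in
/-- The dilates of a simplex with `n` vertices are polynomial of degree less than `n`. -/
theorem polyDegLT_polytope_card (S : Finset V) (hS : S.Nonempty) :
    ∀ φ : ConvexBody V → A, IsConvexBodyValuation φ → IsTranslationInvariantOnBodies φ →
      PolyDegLT S.card fun t => φ (t • polytope S) := by
  induction hS using Finset.Nonempty.cons_induction with
  | singleton v =>
    intro φ hval htrans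
    refine .of_const fun t => ?_
    have hp : polytope {v} = (0 : ConvexBody V) + ConvexBody.point v := by
      ext1
      rw [coe_polytope (by simp), zero_add, Finset.coe_singleton, convexHull_singleton]
      rfl
    rw [hp, htrans.smul_add_point, htrans.smul_add_point, smul_zero, smul_zero]
  | cons v S hv hS ih =>
    intro φ hval htrans
    rw [Finset.card_cons, Finset.cons_eq_insert]
    refine .of_fwdDiff fun b => ?_
    -- Translating by $-v$ puts the apex of the cone at the origin.
    set K := polytope S + ConvexBody.point (-v) with hKdef
    set C := polytope (insert v S) + ConvexBody.point (-v) with hCdef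
    have hmem : ∀ (P : ConvexBody V) x, x ∈ P + ConvexBody.point (-v) ↔ x + v ∈ P := by
      intro P x
      rw [← SetLike.mem_coe, ConvexBody.coe_add]
      change x ∈ (P : Set V) + {-v} ↔ _
      rw [Set.add_singleton, Set.mem_image]
      exact ⟨by rintro ⟨y, hy, rfl⟩; simpa using hy, fun h => ⟨_, h, by simp⟩⟩
    have hC : ∀ x, x ∈ C ↔ ∃ s : ℝ, 0 ≤ s ∧ s ≤ 1 ∧ ∃ k ∈ K, x = s • k := by
      intro x
      rw [hmem, ← SetLike.mem_coe, coe_polytope (Finset.insert_nonempty _ _), Finset.coe_insert,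
        convexHull_insert hS.to_set, mem_convexJoin]
      constructor
      · rintro ⟨v', hv', y, hy, p, q, hp, hq, hpq, h⟩
        rw [Set.mem_singleton_iff.1 hv'] at h
        refine ⟨q, hq, by linarith, y - v, (hmem _ _).2 ?_, ?_⟩
        · rwa [sub_add_cancel, ← SetLike.mem_coe, coe_polytope hS]
        · rw [← add_sub_cancel_right x v, ← h, show p = 1 - q by linarith]
          module
      · rintro ⟨s, hs0, hs1, k, hk, rfl⟩
        refine ⟨v, rfl, k + v, ?_, 1 - s, s, by linarith, hs0, by ring, by module⟩
        rw [← coe_polytope hS]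
        exact (hmem _ _).1 hk
    have heq : (fun t : ℝ≥0 => φ ((t + b) • polytope (insert v S)) - φ (t • polytope (insert v S)))
        = fun t => φ (t • polytope S + b • C) - φ (t • polytope S) := by
      funext t
      rw [← htrans.smul_add_point _ (-v), ← htrans.smul_add_point (polytope (insert v S)) (-v) t,
        ← hCdef, hval.smul_cone hC, ← htrans.smul_add_point (polytope S) (-v) t,
        (htrans.comp_add_right (b • C)).smul_add_point]
    rw [heq]
    exact (ih _ (hval.comp_add_right _) (htrans.comp_add_right _)).sub (ih φ hval htrans)

/-! ### Cutting a convex hull through a point of an edge. -/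

theorem Convex.three_mem {M : Set V} (hM : Convex ℝ M) {x y z : V} (hx : x ∈ M) (hy : y ∈ M)
    (hz : z ∈ M) {p q r : ℝ} (hp : 0 ≤ p) (hq : 0 ≤ q) (hr : 0 ≤ r) (h : p + q + r = 1) :
    p • x + q • y + r • z ∈ M := by
  have := hM.sum_mem (t := Finset.univ) (w := ![p, q, r]) (z := ![x, y, z])
    (by simp [Fin.forall_fin_succ, hp, hq, hr]) (by simp [Fin.sum_univ_three, h])
    (by simp [Fin.forall_fin_succ, hx, hy, hz])
  simpa [Fin.sum_univ_three] using this

theorem mem_convexHull_insert_insert {R : Set V} (hR : R.Nonempty) {u v x : V} :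
    x ∈ convexHull ℝ (insert u (insert v R)) ↔ ∃ a b c : ℝ, 0 ≤ a ∧ 0 ≤ b ∧ 0 ≤ c ∧
      a + b + c = 1 ∧ ∃ k ∈ convexHull ℝ R, x = a • u + b • v + c • k := by
  constructor
  · rw [convexHull_insert (Set.insert_nonempty _ _), convexHull_insert hR, mem_convexJoin]
    rintro ⟨_, rfl, y, hy, p, q, hp, hq, hpq, rfl⟩
    obtain ⟨_, rfl, k, hk, p', q', hp', hq', hpq', rfl⟩ := mem_convexJoin.1 hy
    refine ⟨p, q * p', q * q', hp, by positivity, by positivity, ?_, k, hk, by module⟩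
    rw [add_assoc, ← mul_add, hpq', mul_one, hpq]
  · rintro ⟨a, b, c, ha, hb, hc, h, k, hk, rfl⟩
    exact (convex_convexHull ℝ _).three_mem (subset_convexHull ℝ _ (by simp))
      (subset_convexHull ℝ _ (by simp))
      (convexHull_mono ((Set.subset_insert _ _).trans (Set.subset_insert _ _)) hk) ha hb hc h

/-- Cutting the convex hull of `u`, `v` and `R` through a point `w` of the edge `uv`. -/
theorem convexHull_union_of_mem_segment {R : Set V} (hR : R.Nonempty) {u v w : V}
    (hw : w ∈ segment ℝ u v) : convexHull ℝ (insert u (insert v R)) =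
      convexHull ℝ (insert w (insert u R)) ∪ convexHull ℝ (insert w (insert v R)) := by
  obtain ⟨p, q, hp, hq, hpq, rfl⟩ := hw
  refine Set.Subset.antisymm (fun x hx => ?_) (Set.union_subset ?_ ?_)
  · obtain ⟨a, b, c, ha, hb, hc, h, k, hk, rfl⟩ := (mem_convexHull_insert_insert hR).1 hx
    -- The comparison decides on which side of $w=pu+qv$ the point lies. On the side of $u$, $v$ is
    -- eliminated by $bv=(b/q)(w-pu)$; the other side is symmetric.
    rcases le_total (b * p) (a * q) with hab | hab
    · left
      rw [mem_convexHull_insert_insert hR]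
      rcases eq_or_lt_of_le hq with rfl | hq
      · obtain rfl : p = 1 := by linarith
        obtain rfl : b = 0 := by linarith
        exact ⟨0, a, c, le_rfl, ha, hc, by linarith, k, hk, by module⟩
      · refine ⟨b / q, a - b * p / q, c, by positivity, ?_, hc, ?_, k, hk, ?_⟩
        · rw [sub_nonneg, div_le_iff₀ hq]; exact hab
        · field_simp; linear_combination q * h - b * hpq
        · have : b = b / q * q := by field_simp
          rw [mul_div_right_comm]
          nth_rewrite 1 [this]
          module
    · right
      rw [mem_convexHull_insert_insert hR]
      rcases eq_or_lt_of_le hp with rfl | hp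
      · obtain rfl : q = 1 := by linarith
        obtain rfl : a = 0 := by linarith
        exact ⟨0, b, c, le_rfl, hb, hc, by linarith, k, hk, by module⟩
      · refine ⟨a / p, b - a * q / p, c, by positivity, ?_, hc, ?_, k, hk, ?_⟩
        · rw [sub_nonneg, div_le_iff₀ hp]; exact hab
        · field_simp; linear_combination p * h - a * hpq
        · have : a = a / p * p := by field_simp
          rw [mul_div_right_comm]
          nth_rewrite 1 [this]
          module
  all_goals
    refine convexHull_min ?_ (convex_convexHull ℝ _)
    have hw : p • u + q • v ∈ convexHull ℝ (insert u (insert v R)) :=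
      (convex_convexHull ℝ _) (subset_convexHull ℝ _ (by simp))
        (subset_convexHull ℝ _ (by simp)) hp hq hpq
    rw [Set.insert_subset_iff]
    refine ⟨hw, Set.Subset.trans ?_ (subset_convexHull ℝ _)⟩
  · exact Set.insert_subset_insert (Set.subset_insert _ _)
  · exact Set.subset_insert _ _

theorem convexHull_inter_of_mem_segment {R : Set V} (hR : R.Nonempty) {u v w : V}
    (hw : w ∈ segment ℝ u v) : convexHull ℝ (insert w R) =
      convexHull ℝ (insert w (insert u R)) ∩ convexHull ℝ (insert w (insert v R)) := by
  obtain ⟨p, q, hp, hq, hpq, hw⟩ := hw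
  refine Set.Subset.antisymm (Set.subset_inter
    (convexHull_mono (Set.insert_subset_insert (Set.subset_insert _ _)))
    (convexHull_mono (Set.insert_subset_insert (Set.subset_insert _ _)))) ?_
  rintro x ⟨h₁, h₂⟩
  obtain ⟨b, a, c, hb, ha, hc, h, k, hk, hx⟩ := (mem_convexHull_insert_insert hR).1 h₁
  obtain ⟨a', b', c', ha', hb', hc', h', k', hk', hx'⟩ := (mem_convexHull_insert_insert hR).1 h₂
  have hM := convex_convexHull ℝ (insert w R)
  have hwM : w ∈ convexHull ℝ (insert w R) := subset_convexHull ℝ _ (by simp)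
  have hkM := convexHull_mono (Set.subset_insert w R) hk
  have hkM' := convexHull_mono (Set.subset_insert w R) hk'
  rcases eq_or_lt_of_le ha with rfl | ha
  · rw [hx, zero_smul, add_zero]
    exact hM hwM hkM hb hc (by linarith)
  rcases eq_or_lt_of_le hb' with rfl | hb'
  · rw [hx', zero_smul, add_zero]
    exact hM hwM hkM' ha' hc' (by linarith)
  -- Weighting the two expressions for $x$ by $pb'$ and $qa$ makes the $u$ and $v$ terms combine to
  -- $ab'(pu+qv)=ab'w$. No affine independence is needed.
  have hD : 0 < p * b' + q * a := by
    rcases eq_or_lt_of_le hp with rfl | hp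
    · have : q = 1 := by linarith
      rw [this]; linarith
    · have := mul_pos hp hb'
      have := mul_nonneg hq ha.le
      linarith
  set D := p * b' + q * a with hDdef
  have hxD : x = ((a * b' + p * b' * b + q * a * a') / D) • w + (p * b' * c / D) • k +
      (q * a * c' / D) • k' := by
    have e : D • x = (a * b' + p * b' * b + q * a * a') • w + (p * b' * c) • k +
        (q * a * c') • k' := by
      calc D • x = (p * b') • x + (q * a) • x := by rw [hDdef, add_smul]
        _ = (p * b') • (b • w + a • u + c • k) + (q * a) • (a' • w + b' • v + c' • k') := by
          rw [← hx, ← hx']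
        _ = (a * b') • (p • u + q • v) + (p * b' * b + q * a * a') • w + (p * b' * c) • k +
            (q * a * c') • k' := by module
        _ = _ := by rw [hw]; module
    rw [← inv_smul_smul₀ hD.ne' x, e]
    simp only [smul_add, smul_smul, div_eq_inv_mul]
  rw [hxD]
  refine hM.three_mem hwM hkM hkM' (by positivity) (by positivity) (by positivity) ?_
  field_simp
  rw [hDdef]
  linear_combination -(a * b') * hpq + (p * b') * h + (q * a) * h'

end Valuations

/-! ### Alternating sums over subsets of a point set. -/

section AlternatingSums

variable {V : Type*} [NormedAddCommGroup V] [NormedSpace ℝ V] {B : Type*} [AddCommGroup B]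

open Classical in
/-- The alternating sum of `c (R ∪ T)` over all sublists `T` of `l`. -/
noncomputable def altSum (c : Finset V → B) : List V → Finset V → B
  | [], R => c R
  | v :: l, R => altSum c l (insert v R) - altSum c l R

open Classical in
theorem altSum_cut {c : Finset V → B}
    (hcut : ∀ (R : Finset V) (u v w : V), R.Nonempty → w ∈ segment ℝ u v →
      c (insert u (insert v R)) = c (insert w (insert u R)) + c (insert w (insert v R)) -
        c (insert w R))
    (l : List V) (R : Finset V) (hR : R.Nonempty) {u v w : V} (hw : w ∈ segment ℝ u v) :
    altSum c l (insert u (insert v R)) = altSum c l (insert w (insert u R)) +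
      altSum c l (insert w (insert v R)) - altSum c l (insert w R) := by
  induction l generalizing R with
  | nil => exact hcut R u v w hR hw
  | cons z l ih =>
    have h₂ : ∀ a b, insert z (insert a (insert b R)) = insert a (insert b (insert z R)) :=
      fun a b => by rw [Finset.insert_comm z a, Finset.insert_comm z b]
    simp only [altSum]
    rw [h₂, h₂, h₂, Finset.insert_comm z w, ih _ (Finset.insert_nonempty _ _), ih R hR]
    abel

/-- The two points are merged into their barycentre with the weights they carry in $x$; if both
weights vanish, $w$ is irrelevant. -/
theorem exists_mem_segment_mem_convexHull_insert {L : Set V} {u v x : V}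
    (hx : x ∈ convexHull ℝ (insert u (insert v L))) :
    ∃ w ∈ segment ℝ u v, x ∈ convexHull ℝ (insert w L) := by
  rcases L.eq_empty_or_nonempty with rfl | hL
  · refine ⟨x, ?_, subset_convexHull ℝ _ (by simp)⟩
    rwa [← convexHull_pair, ← LawfulSingleton.insert_empty_eq v]
  · obtain ⟨a, b, c, ha, hb, hc, h, k, hk, rfl⟩ := (mem_convexHull_insert_insert hL).1 hx
    have hk' := convexHull_mono (𝕜 := ℝ) (Set.subset_insert u L) hk
    rcases eq_or_lt_of_le (add_nonneg ha hb) with hab | hab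
    · obtain rfl : a = 0 := by linarith
      obtain rfl : b = 0 := by linarith
      refine ⟨u, left_mem_segment ℝ u v, ?_⟩
      obtain rfl : c = 1 := by linarith
      simpa using hk'
    · refine ⟨(a / (a + b)) • u + (b / (a + b)) • v, ⟨_, _, by positivity, by positivity, ?_, rfl⟩, ?_⟩
      · rw [← add_div, div_self hab.ne']
      · rw [convexHull_insert hL, mem_convexJoin]
        refine ⟨_, rfl, k, hk, a + b, c, hab.le, hc, h, ?_⟩
        rw [smul_add, smul_smul, smul_smul, mul_div_cancel₀ _ hab.ne', mul_div_cancel₀ _ hab.ne']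

open Classical in
/-- If the convex hulls of `l` and `R` meet, then the alternating sum vanishes. -/
theorem altSum_eq_zero {c : Finset V → B}
    (hcut : ∀ (R : Finset V) (u v w : V), R.Nonempty → w ∈ segment ℝ u v →
      c (insert u (insert v R)) = c (insert w (insert u R)) + c (insert w (insert v R)) -
        c (insert w R))
    (hins : ∀ (R : Finset V) (v : V), v ∈ convexHull ℝ (R : Set V) → c (insert v R) = c R)
    (n : ℕ) (l : List V) (hl : l.length = n) (R : Finset V) {x : V}
    (hx : x ∈ convexHull ℝ {y | y ∈ l}) (hxR : x ∈ convexHull ℝ (R : Set V)) :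
    altSum c l R = 0 := by
  induction n generalizing l R with
  | zero =>
    obtain rfl := List.length_eq_zero_iff.1 hl
    simp at hx
  | succ n ih =>
    match l, hl with
    | [v], _ =>
      obtain rfl : x = v := by simpa using hx
      simp only [altSum, hins R x hxR, sub_self]
    | u :: v :: l, hl =>
      have hset : {y | y ∈ u :: v :: l} = insert u (insert v {y | y ∈ l}) := by
        ext; simp
      rw [hset] at hx
      obtain ⟨w, hw, hxw⟩ := exists_mem_segment_mem_convexHull_insert hx
      have hset' : insert w {y | y ∈ l} = {y | y ∈ w :: l} := by
        ext; simp
      rw [hset'] at hxw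
      -- Merging $u$ and $v$ into $w$ shortens the list, so by induction inserting $w$ changes
      -- nothing for any $R'$ whose hull contains $x$. The cut relation then makes the four terms
      -- cancel.
      have key : ∀ R' : Finset V, x ∈ convexHull ℝ (R' : Set V) →
          altSum c l (insert w R') - altSum c l R' = 0 :=
        fun R' hR' => ih (w :: l) (by simpa using hl) R' hxw hR'
      have hmono : ∀ z, x ∈ convexHull ℝ ((insert z R : Finset V) : Set V) := fun z => by
        rw [Finset.coe_insert]
        exact convexHull_mono (Set.subset_insert _ _) hxR
      have hR : R.Nonempty := by
        rw [← Finset.coe_nonempty, ← convexHull_nonempty_iff (𝕜 := ℝ)]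
        exact ⟨x, hxR⟩
      simp only [altSum]
      rw [Finset.insert_comm v u, altSum_cut hcut l R hR hw]
      have h₁ := key _ (hmono u)
      have h₂ := key _ (hmono v)
      have h₃ := key R hxR
      rw [sub_eq_zero] at h₁ h₂ h₃
      rw [h₁, h₂, h₃]
      abel

open Classical in
-- Only the full sublist contributes the whole union as a leading term; every other term has fewer
-- points and lies in $H$.
theorem altSum_sub_mem {V : Type*} {c : Finset V → B} (H : AddSubgroup B) (l : List V) (R : Finset V)
    (h : ∀ S ⊆ l.toFinset ∪ R, R ⊆ S → S.card < l.length + R.card → c S ∈ H) :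
    altSum c l R - c (l.toFinset ∪ R) ∈ H := by
  induction l generalizing R with
  | nil => simp [altSum]
  | cons v l ih =>
    have hins : (v :: l).toFinset ∪ R = l.toFinset ∪ insert v R := by
      ext; simp
    have hcard := Finset.card_insert_le v R
    have h₁ := ih (insert v R) fun S hS hRS hc =>
      h S (hins ▸ hS) ((Finset.subset_insert _ _).trans hRS)
        (by rw [List.length_cons]; omega)
    have hsub : l.toFinset ∪ R ⊆ (v :: l).toFinset ∪ R := by
      rw [hins]
      exact Finset.union_subset_union_right (Finset.subset_insert _ _)
    have h₂ := ih R fun S hS hRS hc => h S (hS.trans hsub) hRS (by rw [List.length_cons]; omega)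
    have h₃ : c (l.toFinset ∪ R) ∈ H := h _ hsub Finset.subset_union_right (by
      have := Finset.card_union_le l.toFinset R
      have := l.toFinset_card_le
      rw [List.length_cons]; omega)
    rw [hins]
    have : altSum c (v :: l) R - c (l.toFinset ∪ insert v R) =
        (altSum c l (insert v R) - c (l.toFinset ∪ insert v R)) -
          ((altSum c l R - c (l.toFinset ∪ R)) + c (l.toFinset ∪ R)) := by
      simp only [altSum]; abel
    rw [this]
    exact H.sub_mem h₁ (H.add_mem h₂ h₃)

end AlternatingSums

/-! ### Polytopes, approximation and the main theorem. -/

section Main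

variable {V : Type*} [NormedAddCommGroup V] [NormedSpace ℝ V] {A : Type*} [AddCommGroup A]

variable (A) in
/-- The polynomial maps of degree less than `n`, as a subgroup. -/
def polyDegLTSubgroup (n : ℕ) : AddSubgroup (ℝ≥0 → A) :=
  AddSubgroup.ofSub {g | PolyDegLT n g} ⟨0, fun l _ t => iterDiff_zero l t⟩
    fun f hf g hg => by
      rw [← sub_eq_add_neg]
      exact PolyDegLT.sub (f := f) (g := g) hf hg

open Classical in
theorem IsConvexBodyValuation.smul_polytope_cut {φ : ConvexBody V → A}
    (hval : IsConvexBodyValuation φ) (t : ℝ≥0) (R : Finset V) (u v w : V) (hR : R.Nonempty)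
    (hw : w ∈ segment ℝ u v) :
    φ (t • polytope (insert u (insert v R))) = φ (t • polytope (insert w (insert u R))) +
      φ (t • polytope (insert w (insert v R))) - φ (t • polytope (insert w R)) := by
  have hU : (polytope (insert u (insert v R)) : Set V) =
      (polytope (insert w (insert u R)) : Set V) ∪ polytope (insert w (insert v R)) := by
    simp only [coe_polytope (Finset.insert_nonempty _ _), Finset.coe_insert]
    exact convexHull_union_of_mem_segment hR.to_set hw
  have hI : (polytope (insert w R) : Set V) =
      (polytope (insert w (insert u R)) : Set V) ∩ polytope (insert w (insert v R)) := by
    simp only [coe_polytope (Finset.insert_nonempty _ _), Finset.coe_insert]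
    exact convexHull_inter_of_mem_segment hR.to_set hw
  refine hval _ _ _ _ ?_ ?_
  · rw [ConvexBody.coe_smul', ConvexBody.coe_smul', ConvexBody.coe_smul', hU, Set.smul_set_union]
  · rw [ConvexBody.coe_smul', ConvexBody.coe_smul', ConvexBody.coe_smul', hI]
    rcases eq_or_ne t 0 with rfl | ht
    · rw [← hI, Set.zero_smul_set (ConvexBody.nonempty _), Set.zero_smul_set (ConvexBody.nonempty _),
        Set.zero_smul_set (ConvexBody.nonempty _), Set.inter_self]
    · exact Set.smul_set_inter₀ ht

open Classical in
/-- The dilates of a polytope of dimension less than `n` are polynomial of degree less than `n`. -/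
theorem polyDegLT_polytope [FiniteDimensional ℝ V] {φ : ConvexBody V → A}
    (hval : IsConvexBodyValuation φ) (htrans : IsTranslationInvariantOnBodies φ) (n m : ℕ)
    (S : Finset V) (hS : S.Nonempty) (hm : S.card = m)
    (hn : Module.finrank ℝ (vectorSpan ℝ (S : Set V)) + 1 ≤ n) :
    PolyDegLT n fun t => φ (t • polytope S) := by
  induction m using Nat.strong_induction_on generalizing S with
  | _ m ih =>
  by_cases hSn : S.card ≤ n
  · exact (polyDegLT_polytope_card S hS φ hval htrans).mono hSn
  -- There are more points than the dimension plus one, so they are dependent and have a Radon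
  -- partition.
  have hdep : ¬ AffineIndependent ℝ (Subtype.val : S → V) := by
    intro h
    have := h.card_le_finrank_succ
    rw [Fintype.card_coe, show Set.range (Subtype.val : S → V) = S from Subtype.range_coe] at this
    omega
  obtain ⟨I, x, hxI, hxR⟩ := Convex.radon_partition hdep
  let T : Finset V := I.toFinset.map (Function.Embedding.subtype _)
  let R : Finset V := Iᶜ.toFinset.map (Function.Embedding.subtype _)
  have hT : (T : Set V) = Subtype.val '' I := by simp [T]
  have hR : (R : Set V) = Subtype.val '' Iᶜ := by simp [R]
  have hTR : T ∪ R = S := by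
    rw [← Finset.coe_inj, Finset.coe_union, hT, hR, ← Set.image_union, Set.union_compl_self]
    simp
  have hcard : T.card + R.card = S.card := by
    rw [← Finset.card_union_of_disjoint, hTR]
    rw [← Finset.disjoint_coe, hT, hR, Set.disjoint_image_iff Subtype.val_injective]
    exact disjoint_compl_right
  rw [← hT] at hxI
  rw [← hR] at hxR
  have hRne : R.Nonempty := by
    rw [← Finset.coe_nonempty, ← convexHull_nonempty_iff (𝕜 := ℝ)]
    exact ⟨x, hxR⟩
  let c : Finset V → ℝ≥0 → A := fun S t => φ (t • polytope S)
  have hzero : altSum c T.toList R = 0 := by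
    refine altSum_eq_zero (fun R u v w hR hw => ?_) (fun R v hv => ?_) _ _ rfl R (x := x) ?_ hxR
    · funext t
      exact hval.smul_polytope_cut t R u v w hR hw
    · have hR : R.Nonempty := by
        rw [← Finset.coe_nonempty, ← convexHull_nonempty_iff (𝕜 := ℝ)]
        exact ⟨v, hv⟩
      have : polytope (insert v R) = polytope R := by
        ext1
        rw [coe_polytope hR, coe_polytope (Finset.insert_nonempty _ _), Finset.coe_insert]
        exact (convexHull_min (Set.insert_subset hv (subset_convexHull ℝ _))
          (convex_convexHull ℝ _)).antisymm (convexHull_mono (Set.subset_insert _ _))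
      simp only [c, this]
    · simpa using hxI
  -- The alternating sum vanishes, so the term of $S$ is, up to sign, a combination of terms of
  -- proper subsets, which have no larger dimension.
  have := altSum_sub_mem (c := c) (polyDegLTSubgroup A n) T.toList R (by
    intro S' hS' hRS' hc
    rw [Finset.toList_toFinset, hTR] at hS'
    rw [Finset.length_toList, hcard] at hc
    refine ih S'.card (by omega) S' (hRne.mono hRS') rfl (le_trans ?_ hn)
    gcongr
    exact Submodule.finrank_mono (vectorSpan_mono ℝ (Finset.coe_subset.2 hS')))
  rw [hzero, zero_sub, Finset.toList_toFinset, hTR] at this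
  exact neg_mem_iff.1 this

theorem ConvexBody.continuous_nnreal_smul (X : ConvexBody V) :
    Continuous fun t : ℝ≥0 => t • X := by
  obtain ⟨C, hC0, hC⟩ := X.isBounded.exists_pos_norm_le
  have key : ∀ s t : ℝ≥0, ∀ x ∈ ((s • X : ConvexBody V) : Set V),
      ∃ y ∈ ((t • X : ConvexBody V) : Set V), dist x y ≤ C * dist s t := by
    rintro s t _ ⟨k, hk, rfl⟩
    refine ⟨(t : ℝ) • k, Set.smul_mem_smul_set (a := t) hk, ?_⟩
    change dist ((s : ℝ) • k) _ ≤ _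
    rw [dist_eq_norm, ← sub_smul, norm_smul, mul_comm, NNReal.dist_eq, Real.norm_eq_abs]
    gcongr
    exact hC k hk
  refine (LipschitzWith.of_dist_le_mul (K := ⟨C, hC0.le⟩) fun s t => ?_).continuous
  refine Metric.hausdorffDist_le_of_mem_dist (by positivity) (key s t) fun x hx => ?_
  rw [dist_comm s t]
  exact key t s x hx

/-- The points form a finite $\varepsilon$-net chosen inside $X$, so that the dimension of the
polytope does not exceed that of $X$. -/
theorem ConvexBody.exists_polytope_dist_le (X : ConvexBody V) {ε : ℝ} (hε : 0 < ε) :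
    ∃ S : Finset V, S.Nonempty ∧ (S : Set V) ⊆ X ∧
      ∀ t : ℝ≥0, dist (t • polytope S) (t • X) ≤ t * ε := by
  obtain ⟨T, hTX, hTfin, hcov⟩ := X.isCompact.finite_cover_balls hε
  lift T to Finset V using hTfin
  have hne : T.Nonempty := by
    obtain ⟨x, hx⟩ := X.nonempty
    obtain ⟨y, hy, -⟩ := Set.mem_iUnion₂.1 (hcov hx)
    exact ⟨y, hy⟩
  refine ⟨T, hne, hTX, fun t => ?_⟩
  refine Metric.hausdorffDist_le_of_mem_dist (by positivity) ?_ ?_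
  · rintro _ ⟨k, hk, rfl⟩
    refine ⟨t • k, Set.smul_mem_smul_set ?_, (dist_self (t • k)).trans_le (by positivity)⟩
    rw [coe_polytope hne] at hk
    exact convexHull_min hTX X.convex hk
  · rintro _ ⟨k, hk, rfl⟩
    obtain ⟨y, hy, hky⟩ := Set.mem_iUnion₂.1 (hcov hk)
    refine ⟨t • y, Set.smul_mem_smul_set ?_, ?_⟩
    · rw [coe_polytope hne]
      exact subset_convexHull ℝ _ hy
    · change dist ((t : ℝ) • k) ((t : ℝ) • y) ≤ _
      rw [dist_smul₀, Real.norm_of_nonneg t.coe_nonneg]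
      gcongr
      exact (Metric.mem_ball.1 hky).le

theorem polyDegLT_convexBody [FiniteDimensional ℝ V] [TopologicalSpace A]
    [IsTopologicalAddGroup A] [T2Space A] {φ : ConvexBody V → A} (hcont : Continuous φ)
    (hval : IsConvexBodyValuation φ) (htrans : IsTranslationInvariantOnBodies φ)
    (X : ConvexBody V) : PolyDegLT (convexBodyDim X + 1) fun t => φ (t • X) := by
  choose S hS hSX hdist using fun i : ℕ =>
    X.exists_polytope_dist_le (ε := 1 / ((i : ℝ) + 1)) (by positivity)
  refine PolyDegLT.of_tendsto (F := Filter.atTop) (u := fun i t => φ (t • polytope (S i)))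
    (fun i => polyDegLT_polytope hval htrans _ _ (S i) (hS i) rfl ?_) fun t => ?_
  · gcongr
    rw [convexBodyDim, direction_affineSpan]
    exact Submodule.finrank_mono (vectorSpan_mono ℝ (hSX i))
  · refine (hcont.tendsto _).comp ?_
    rw [tendsto_iff_dist_tendsto_zero]
    refine squeeze_zero (fun _ => dist_nonneg) (fun i => hdist i t) ?_
    simpa using (tendsto_one_div_add_atTop_nhds_zero_nat (𝕜 := ℝ)).const_mul (t : ℝ)

end Main

theorem theoremC {V : Type*} [NormedAddCommGroup V] [NormedSpace ℝ V] [FiniteDimensional ℝ V]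
    {A : Type*} [AddCommGroup A] [TopologicalSpace A] [IsTopologicalAddGroup A] [T2Space A]
    (φ : ConvexBody V → A) (hcont : Continuous φ) (hval : IsConvexBodyValuation φ)
    (htrans : IsTranslationInvariantOnBodies φ)
    (X : ConvexBody V) (d : ℕ) (hd : convexBodyDim X ≤ d) :
    ∃! f : A × (Fin d → (ℝ≥0 →ₙ+ A)),
      (∀ i, Continuous (f.2 i)) ∧
      ∀ t : ℝ≥0, φ (t • X) = f.1 + ∑ i : Fin d, f.2 i (t ^ ((i : ℕ) + 1)) := by
  obtain ⟨c, f, hf, h⟩ := exists_sum_hom_pow (hcont.comp X.continuous_nnreal_smul) d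
    ((polyDegLT_convexBody hcont hval htrans X).mono (by omega))
  refine ⟨(c, f), ⟨hf, h⟩, fun p hp => ?_⟩
  obtain ⟨h₁, h₂⟩ := eq_of_sum_hom_pow_eq d p.1 c p.2 f fun t => (hp.2 t).symm.trans (h t)
  exact Prod.ext h₁ h₂
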